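/- Call a function $f:\mathbb{R}^3\to\mathbb{R}$ $2+1$-convex if it is convex along every line of $\mathbb{R}^3$ whose direction is horizontal (of the form $(a,b,0)$) or vertical (of the form $(0,0,c)$). For a compact set $K\subset\mathbb{R}^3$ let the $2+1$-convex hull $K^{rc}$ be the set of all $p\in\mathbb{R}^3$ such that $f(p)\le \sup_K f$ for every $2+1$-convex function $f:\mathbb{R}^3\to\mathbb{R}$. A shovel is a set of the form $\{(x,y,z)\in\mathbb{R}^3 : l(x,y)>0,\ \varepsilon(z-z_0)>0\}$ with $z_0\in\mathbb{R}$, an affine functional $l:\mathbb{R}^2\to\mathbb{R}$ and $\varepsilon\in\{-1,1\}$; the polyconvex$++$ hull $K^{pc++}$ is the complement of the union of all shovels that do not intersect $K$. Let $$S=\{(1,0,0),(0,0,0),(0,0,1),(0,1,1),(0,1,2),(1,1,2)\}$$ be the Spiral Staircase set. Then: (i) $S^{pc++}$ contains the five closed segments that join consecutive points of $S$ (in the order listed), and it also contains the closed horizontal triangle with vertices $(0,0,1)$, $(0,1,1)$ and $(1/2,1/2,1)$; (ii) $S^{rc}$ is exactly the union of these five segments; (iii) consequently $S^{rc}\subsetneq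 S^{pc++}$. -/

import Mathlib

/-- The cone of directions of `2+1`-convexity (separate convexity in `ℝ² ⊕ ℝ`): the directions
`v = (a, b, c)` that are horizontal (`c = 0`) or vertical (`a = b = 0`). -/
def cone21 : Set (ℝ × ℝ × ℝ) :=
  {v | v.2.2 = 0 ∨ (v.1 = 0 ∧ v.2.1 = 0)}

/-- A real function on `ℝ³` is `2+1`-convex if it is convex along every line whose direction
is horizontal or vertical. -/
def IsConvex21 (f : ℝ × ℝ × ℝ → ℝ) : Prop :=
  ∀ p v : ℝ × ℝ × ℝ, v ∈ cone21 → ConvexOn ℝ Set.univ (fun t : ℝ => f (p + t • v))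

/-- The `2+1`-convex hull `K^rc`: the points that cannot be separated from `K` by a `2+1`-convex
function, i.e. the points `p` with `f p ≤ sup_K f` for every `2+1`-convex `f : ℝ³ → ℝ`. -/
def rcHull (K : Set (ℝ × ℝ × ℝ)) : Set (ℝ × ℝ × ℝ) :=
  {p | ∀ f : ℝ × ℝ × ℝ → ℝ, IsConvex21 f → ∀ c : ℝ, (∀ q ∈ K, f q ≤ c) → f p ≤ c}

/-- The shovel `{(x, y, z) : l(x, y) > 0, ε (z - z₀) > 0}`. -/
def shovel (l : (ℝ × ℝ) →ᵃ[ℝ] ℝ) (ε z₀ : ℝ) : Set (ℝ × ℝ × ℝ) :=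
  {p | 0 < l (p.1, p.2.1) ∧ 0 < ε * (p.2.2 - z₀)}

/-- A subset of `ℝ³` is a shovel if it is `shovel l ε z₀` for an affine functional `l` on `ℝ²`,
a sign `ε ∈ {-1, 1}` and a height `z₀`. -/
def IsShovel (T : Set (ℝ × ℝ × ℝ)) : Prop :=
  ∃ (l : (ℝ × ℝ) →ᵃ[ℝ] ℝ) (ε z₀ : ℝ), (ε = -1 ∨ ε = 1) ∧ T = shovel l ε z₀

/-- The polyconvex++ hull `K^pc++`: the complement of the union of all the shovels that do not
intersect `K`. -/
def pcppHull (K : Set (ℝ × ℝ × ℝ)) : Set (ℝ × ℝ × ℝ) :=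
  (⋃₀ {T | IsShovel T ∧ Disjoint T K})ᶜ

/-- The Spiral Staircase set. -/
def spiralStaircase : Set (ℝ × ℝ × ℝ) :=
  {(1, 0, 0), (0, 0, 0), (0, 0, 1), (0, 1, 1), (0, 1, 2), (1, 1, 2)}

/-- The union of the five closed segments that join consecutive points of the Spiral Staircase
set. -/
def staircaseSegments : Set (ℝ × ℝ × ℝ) :=
  segment ℝ (1, 0, 0) (0, 0, 0) ∪ segment ℝ (0, 0, 0) (0, 0, 1) ∪
    segment ℝ (0, 0, 1) (0, 1, 1) ∪ segment ℝ (0, 1, 1) (0, 1, 2) ∪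
    segment ℝ (0, 1, 2) (1, 1, 2)

/-!
The segments lie in the `2+1`-convex hull because consecutive points of the staircase differ by a
horizontal or vertical vector, and a function that is convex along the line through two points is
bounded on the segment between them by the larger of its end values.

For the converse, products `g (x, y) * h z` of nonnegative convex functions are `2+1`-convex
(`isConvex21_mul`). Those of the form `(l (x, y))⁺ * (ε (z - z₀))⁺` are positive exactly on a shovel,
whence `rcHull K ⊆ pcppHull K`; a few of them cut the hull down to the staircase at every height
`z ≠ 1`. At height `1` no shovel can do better than the triangle with vertices `(0, 0)`, `(0, 1)`,
`(1/2, 1/2)`: above or at that height the staircase projects to the vertices of the triangle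
`(0, 0)`, `(0, 1)`, `(1, 1)`, below or at it to those of `(0, 0)`, `(0, 1)`, `(1, 0)`, and the small
triangle is their intersection. There the function `staircaseSeparator`, which vanishes on the
staircase and equals `x` at height `1`, does the separation. In particular `(1/2, 1/2, 1)` lies in
the polyconvex++ hull and not in the `2+1`-convex hull.
-/

/-! ### `2+1`-convex functions -/

theorem IsConvex21.add {f g : ℝ × ℝ × ℝ → ℝ} (hf : IsConvex21 f) (hg : IsConvex21 g) :
    IsConvex21 (fun p => f p + g p) :=
  fun p v hv => (hf p v hv).add (hg p v hv)

theorem isConvex21_mul {g : ℝ × ℝ → ℝ} {h : ℝ → ℝ} (hg : ConvexOn ℝ Set.univ g)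
    (hg0 : ∀ q, 0 ≤ g q) (hh : ConvexOn ℝ Set.univ h) (hh0 : ∀ z, 0 ≤ h z) :
    IsConvex21 (fun p => g (p.1, p.2.1) * h p.2.2) := by
  rintro ⟨x, y, z⟩ ⟨a, b, c⟩ hv
  refine ⟨convex_univ, fun s _ t _ α β hα hβ hαβ => ?_⟩
  obtain rfl : β = 1 - α := by linarith
  rcases hv with hc | ⟨ha, hb⟩
  · obtain rfl : c = 0 := hc
    have key := hg.2 (Set.mem_univ (x + s * a, y + s * b)) (Set.mem_univ (x + t * a, y + t * b))
      hα hβ hαβ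
    have e : α • ((x + s * a, y + s * b) : ℝ × ℝ) + (1 - α) • ((x + t * a, y + t * b) : ℝ × ℝ)
        = (x + (α * s + (1 - α) * t) * a, y + (α * s + (1 - α) * t) * b) := by
      ext <;> simp <;> ring
    rw [e] at key
    have := mul_le_mul_of_nonneg_right key (hh0 z)
    simp only [Prod.smul_mk, Prod.mk_add_mk, smul_eq_mul, mul_zero, add_zero] at this ⊢
    linarith
  · obtain rfl : a = 0 := ha
    obtain rfl : b = 0 := hb
    have key := hh.2 (Set.mem_univ (z + s * c)) (Set.mem_univ (z + t * c)) hα hβ hαβ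
    have e : α • (z + s * c) + (1 - α) • (z + t * c) = z + (α * s + (1 - α) * t) * c := by
      simp only [smul_eq_mul]; ring
    rw [e] at key
    have := mul_le_mul_of_nonneg_left key (hg0 (x, y))
    simp only [Prod.smul_mk, Prod.mk_add_mk, smul_eq_mul, mul_zero, add_zero] at this ⊢
    linarith

/-- An affine function of `(x, y)` times an affine function of `z`: such a product is affine along
horizontal and along vertical lines, so no sign conditions are needed. -/
theorem isConvex21_affine_mul_affine (a b c d e : ℝ) :
    IsConvex21 (fun p => (a + b * p.1 + c * p.2.1) * (d + e * p.2.2)) := by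
  rintro ⟨x, y, z⟩ ⟨v₁, v₂, v₃⟩ hv
  refine ⟨convex_univ, fun s _ t _ α β _ _ hαβ => le_of_eq ?_⟩
  obtain rfl : β = 1 - α := by linarith
  rcases hv with h₃ | ⟨h₁, h₂⟩
  · obtain rfl : v₃ = 0 := h₃
    simp only [Prod.smul_mk, Prod.mk_add_mk, smul_eq_mul]
    ring
  · obtain rfl : v₁ = 0 := h₁
    obtain rfl : v₂ = 0 := h₂
    simp only [Prod.smul_mk, Prod.mk_add_mk, smul_eq_mul]
    ring

theorem convexOn_posPart_affine_prod (a b c : ℝ) :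
    ConvexOn ℝ Set.univ (fun q : ℝ × ℝ => max (a + b * q.1 + c * q.2) 0) := by
  refine ConvexOn.sup (g := fun _ => 0) ⟨convex_univ, fun p _ q _ α β _ _ h => le_of_eq ?_⟩
    (convexOn_const 0 convex_univ)
  obtain rfl : β = 1 - α := by linarith
  simp only [Prod.fst_add, Prod.snd_add, Prod.smul_fst, Prod.smul_snd, smul_eq_mul]
  ring

theorem convexOn_posPart_affine (d e : ℝ) :
    ConvexOn ℝ Set.univ (fun z : ℝ => max (d + e * z) 0) := by
  refine ConvexOn.sup (g := fun _ => 0) ⟨convex_univ, fun p _ q _ α β _ _ h => le_of_eq ?_⟩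
    (convexOn_const 0 convex_univ)
  obtain rfl : β = 1 - α := by linarith
  simp only [smul_eq_mul]
  ring

theorem isConvex21_posPart_mul_posPart (a b c d e : ℝ) :
    IsConvex21 (fun p => max (a + b * p.1 + c * p.2.1) 0 * max (d + e * p.2.2) 0) :=
  isConvex21_mul (convexOn_posPart_affine_prod a b c) (fun _ => le_max_right _ _)
    (convexOn_posPart_affine d e) (fun _ => le_max_right _ _)

/-! ### Hulls of general sets -/

theorem subset_rcHull (K : Set (ℝ × ℝ × ℝ)) : K ⊆ rcHull K :=
  fun p hp _ _ _ hc => hc p hp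

theorem segment_subset_rcHull {K : Set (ℝ × ℝ × ℝ)} {p q : ℝ × ℝ × ℝ} (hp : p ∈ rcHull K)
    (hq : q ∈ rcHull K) (h : q - p ∈ cone21) : segment ℝ p q ⊆ rcHull K := by
  rw [segment_eq_image']
  rintro _ ⟨t, ⟨ht0, ht1⟩, rfl⟩ f hf c hc
  have key := (hf p (q - p) h).2 (Set.mem_univ 0) (Set.mem_univ 1) (sub_nonneg.2 ht1) ht0
    (by ring)
  simp only [smul_eq_mul, mul_zero, mul_one, zero_add, zero_smul, add_zero, one_smul,
    add_sub_cancel] at key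
  nlinarith [hp f hf c hc, hq f hf c hc]

theorem mem_rcHull_affine_le {K : Set (ℝ × ℝ × ℝ)} {p : ℝ × ℝ × ℝ} (hp : p ∈ rcHull K)
    (a b c : ℝ) (h : ∀ q ∈ K, a + b * q.1 + c * q.2.1 ≤ 0) : a + b * p.1 + c * p.2.1 ≤ 0 := by
  simpa using hp _ (isConvex21_affine_mul_affine a b c 1 0) 0 (by simpa using h)

theorem mem_rcHull_height_le {K : Set (ℝ × ℝ × ℝ)} {p : ℝ × ℝ × ℝ} (hp : p ∈ rcHull K)
    (d e : ℝ) (h : ∀ q ∈ K, d + e * q.2.2 ≤ 0) : d + e * p.2.2 ≤ 0 := by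
  simpa using hp _ (isConvex21_affine_mul_affine 1 0 0 d e) 0 (by simpa using h)

/-- The `2+1`-convex hull avoids every region `a + b x + c y > 0`, `d + e z > 0` that misses the
set. -/
theorem mem_rcHull_le_of_height_pos {K : Set (ℝ × ℝ × ℝ)} {p : ℝ × ℝ × ℝ} (hp : p ∈ rcHull K)
    (a b c d e : ℝ) (h : ∀ q ∈ K, a + b * q.1 + c * q.2.1 ≤ 0 ∨ d + e * q.2.2 ≤ 0)
    (hz : 0 < d + e * p.2.2) : a + b * p.1 + c * p.2.1 ≤ 0 := by
  have key := hp _ (isConvex21_posPart_mul_posPart a b c d e) 0 fun q hq => by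
    rcases h q hq with h | h <;> simp [max_eq_right h]
  by_contra! hl
  rw [max_eq_left hl.le, max_eq_left hz.le] at key
  exact absurd key (not_le.2 (mul_pos hl hz))

theorem affineMap_prod_apply (l : (ℝ × ℝ) →ᵃ[ℝ] ℝ) (x y : ℝ) :
    l (x, y) = l (0, 0) + l.linear (1, 0) * x + l.linear (0, 1) * y := by
  have h := l.map_vadd (0, 0) (x, y)
  have e : ((x, y) : ℝ × ℝ) = x • (1, 0) + y • (0, 1) := by ext <;> simp
  have h' : l.linear (x, y) = x * l.linear (1, 0) + y * l.linear (0, 1) := by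
    rw [e, map_add, map_smul, map_smul, smul_eq_mul, smul_eq_mul]
  simp only [vadd_eq_add, Prod.mk_add_mk, add_zero] at h
  rw [h, h']
  ring

theorem rcHull_subset_pcppHull (K : Set (ℝ × ℝ × ℝ)) : rcHull K ⊆ pcppHull K := by
  rintro p hp ⟨_, ⟨⟨l, ε, z₀, -, rfl⟩, hK⟩, hl, hz⟩
  rw [affineMap_prod_apply] at hl
  refine absurd (mem_rcHull_le_of_height_pos hp _ _ _ (-ε * z₀) ε (fun q hq => ?_) (by linarith))
    (not_le.2 hl)
  by_contra! hneg
  refine Set.disjoint_right.1 hK hq ⟨?_, by linarith [hneg.2]⟩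
  rw [affineMap_prod_apply]
  exact hneg.1

/-! ### The Spiral Staircase -/

theorem forall_mem_spiralStaircase {P : ℝ × ℝ × ℝ → Prop} :
    (∀ q ∈ spiralStaircase, P q) ↔ P (1, 0, 0) ∧ P (0, 0, 0) ∧ P (0, 0, 1) ∧ P (0, 1, 1) ∧
      P (0, 1, 2) ∧ P (1, 1, 2) := by
  simp [spiralStaircase]

/-- A `2+1`-convex function that vanishes on the Spiral Staircase and equals `x` at height `1`. At
heights `0`, `1` and `2` it is `2 y + 2 (x - 1)⁺`, `x` and `2 (1 - y)`, and it is affine in `z` on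
either side of height `1`. -/
def staircaseSeparator (p : ℝ × ℝ × ℝ) : ℝ :=
  p.1 + (2 - p.1 - 2 * p.2.1) * (p.2.2 - 1) + 2 * (max (1 - p.1) 0 * max (1 - p.2.2) 0)

theorem isConvex21_staircaseSeparator : IsConvex21 staircaseSeparator := by
  have h := ((isConvex21_affine_mul_affine 0 1 0 1 0).add
    (isConvex21_affine_mul_affine 2 (-1) (-2) (-1) 1)).add
    ((isConvex21_posPart_mul_posPart 1 (-1) 0 1 (-1)).add
      (isConvex21_posPart_mul_posPart 1 (-1) 0 1 (-1)))
  convert h using 1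
  funext p
  have e₁ : 1 + -1 * p.1 + 0 * p.2.1 = 1 - p.1 := by ring
  have e₂ : 1 + -1 * p.2.2 = 1 - p.2.2 := by ring
  rw [e₁, e₂, staircaseSeparator]
  ring

theorem fst_le_zero_of_mem_rcHull_spiralStaircase {x y : ℝ}
    (hp : (x, y, (1 : ℝ)) ∈ rcHull spiralStaircase) : x ≤ 0 := by
  simpa [staircaseSeparator] using hp _ isConvex21_staircaseSeparator 0
    (forall_mem_spiralStaircase.2 (by norm_num [staircaseSeparator]))

theorem mem_segment_of_eq_add_smul {p q r : ℝ × ℝ × ℝ} {t : ℝ} (h0 : 0 ≤ t) (h1 : t ≤ 1)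
    (h : r = p + t • (q - p)) : r ∈ segment ℝ p q := by
  rw [segment_eq_image']
  exact ⟨t, ⟨h0, h1⟩, h.symm⟩

theorem staircaseSegments_subset_rcHull : staircaseSegments ⊆ rcHull spiralStaircase := by
  obtain ⟨h₁, h₂, h₃, h₄, h₅, h₆⟩ := forall_mem_spiralStaircase.1 (subset_rcHull spiralStaircase)
  refine Set.union_subset (Set.union_subset (Set.union_subset (Set.union_subset
    (segment_subset_rcHull h₁ h₂ ?_) (segment_subset_rcHull h₂ h₃ ?_))
    (segment_subset_rcHull h₃ h₄ ?_)) (segment_subset_rcHull h₄ h₅ ?_))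
    (segment_subset_rcHull h₅ h₆ ?_) <;> simp [cone21]

theorem rcHull_subset_staircaseSegments : rcHull spiralStaircase ⊆ staircaseSegments := by
  rintro ⟨x, y, z⟩ hp
  have hx0 := mem_rcHull_affine_le hp 0 (-1) 0 (forall_mem_spiralStaircase.2 (by norm_num))
  have hx1 := mem_rcHull_affine_le hp (-1) 1 0 (forall_mem_spiralStaircase.2 (by norm_num))
  have hy0 := mem_rcHull_affine_le hp 0 0 (-1) (forall_mem_spiralStaircase.2 (by norm_num))
  have hy1 := mem_rcHull_affine_le hp (-1) 0 1 (forall_mem_spiralStaircase.2 (by norm_num))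
  have hz0 := mem_rcHull_height_le hp 0 (-1) (forall_mem_spiralStaircase.2 (by norm_num))
  have hz2 := mem_rcHull_height_le hp (-2) 1 (forall_mem_spiralStaircase.2 (by norm_num))
  dsimp only at hx0 hx1 hy0 hy1 hz0 hz2
  rcases lt_trichotomy z 1 with hz | rfl | hz
  · have hy := mem_rcHull_le_of_height_pos hp 0 0 1 1 (-1)
      (forall_mem_spiralStaircase.2 (by norm_num)) (by dsimp only; linarith)
    dsimp only at hy
    obtain rfl : y = 0 := by linarith
    rcases (show 0 ≤ z by linarith).eq_or_lt with rfl | hz'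
    · refine .inl <| .inl <| .inl <| .inl <| mem_segment_of_eq_add_smul (t := 1 - x)
        (by linarith) (by linarith) ?_
      ext <;> simp
    · have hx := mem_rcHull_le_of_height_pos hp 0 1 (-1) 0 1
        (forall_mem_spiralStaircase.2 (by norm_num)) (by dsimp only; linarith)
      dsimp only at hx
      obtain rfl : x = 0 := by linarith
      refine .inl <| .inl <| .inl <| .inr <| mem_segment_of_eq_add_smul (t := z)
        (by linarith) (by linarith) ?_
      ext <;> simp
  · have hx := fst_le_zero_of_mem_rcHull_spiralStaircase hp
    obtain rfl : x = 0 := by linarith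
    refine .inl <| .inl <| .inr <| mem_segment_of_eq_add_smul (t := y)
      (by linarith) (by linarith) ?_
    ext <;> simp
  · have hy := mem_rcHull_le_of_height_pos hp 1 0 (-1) (-1) 1
      (forall_mem_spiralStaircase.2 (by norm_num)) (by dsimp only; linarith)
    dsimp only at hy
    obtain rfl : y = 1 := by linarith
    rcases (show z ≤ 2 by linarith).eq_or_lt with rfl | hz'
    · refine .inr <| mem_segment_of_eq_add_smul (t := x) (by linarith) (by linarith) ?_
      ext <;> simp
    · have hx := mem_rcHull_le_of_height_pos hp (-1) 1 1 2 (-1)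
        (forall_mem_spiralStaircase.2 (by norm_num)) (by dsimp only; linarith)
      dsimp only at hx
      obtain rfl : x = 0 := by linarith
      refine .inl <| .inr <| mem_segment_of_eq_add_smul (t := z - 1)
        (by linarith) (by linarith) ?_
      ext <;> simp
      ring

theorem triangle_subset_pcppHull :
    convexHull ℝ {((0 : ℝ), (0 : ℝ), (1 : ℝ)), (0, 1, 1), (1 / 2, 1 / 2, 1)} ⊆
      pcppHull spiralStaircase := by
  rintro p hp ⟨_, ⟨⟨l, ε, z₀, hε, rfl⟩, hS⟩, hl, hz⟩
  -- A shovel containing `p` contains a vertex of the triangle: its complement is convex within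
  -- the plane `z = 1`.
  have hconv : Convex ℝ {q : ℝ × ℝ × ℝ | l (q.1, q.2.1) ≤ 0 ∧ q.2.2 = 1} := by
    rintro ⟨x, y, z⟩ ⟨h₁, h₂⟩ ⟨x', y', z'⟩ ⟨h₁', h₂'⟩ α β hα hβ hαβ
    dsimp only at h₁ h₂ h₁' h₂'
    subst h₂ h₂'
    obtain rfl : β = 1 - α := by linarith
    rw [affineMap_prod_apply] at h₁ h₁'
    simp only [Set.mem_ofPred_eq, Prod.smul_mk, Prod.mk_add_mk, smul_eq_mul]
    rw [affineMap_prod_apply]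
    exact ⟨by nlinarith, by ring⟩
  have hvert : ∀ x y z : ℝ, (x, y, z) ∈ spiralStaircase → 0 < ε * (z - z₀) → l (x, y) ≤ 0 :=
    fun x y z hq hzq => not_lt.1 fun hlq => Set.disjoint_right.1 hS hq ⟨hlq, hzq⟩
  have hz1 : p.2.2 = 1 :=
    (convexHull_min (t := {q : ℝ × ℝ × ℝ | q.2.2 = 1}) (by simp [Set.insert_subset_iff])
      (by
        rintro q (hq : _ = _) q' (hq' : _ = _) α β _ _ h
        simp [hq, hq', h]) hp)
  rw [hz1] at hz
  have h0 := hvert 0 0 1 (by simp [spiralStaircase]) hz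
  have h1 := hvert 0 1 1 (by simp [spiralStaircase]) hz
  -- `(1/2, 1/2)` is the midpoint of `(0, 0)` and `(1, 1)`, and of `(1, 0)` and `(0, 1)`.
  have h2 : l (1 / 2, 1 / 2) ≤ 0 := by
    rcases hε with rfl | rfl
    · have h3 := hvert 1 0 0 (by simp [spiralStaircase]) (by linarith)
      rw [affineMap_prod_apply] at h1 h3 ⊢
      linarith
    · have h3 := hvert 1 1 2 (by simp [spiralStaircase]) (by linarith)
      rw [affineMap_prod_apply] at h3 ⊢
      linarith
  refine absurd (convexHull_min ?_ hconv hp).1 (not_le.2 hl)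
  rintro q (rfl | rfl | rfl)
  exacts [⟨h0, rfl⟩, ⟨h1, rfl⟩, ⟨h2, rfl⟩]

theorem mainTheorem7 :
    staircaseSegments ⊆ pcppHull spiralStaircase ∧
    convexHull ℝ {((0 : ℝ), (0 : ℝ), (1 : ℝ)), (0, 1, 1), (1 / 2, 1 / 2, 1)} ⊆
      pcppHull spiralStaircase ∧
    rcHull spiralStaircase = staircaseSegments ∧
    rcHull spiralStaircase ⊂ pcppHull spiralStaircase := by
  have hrc := rcHull_subset_pcppHull spiralStaircase
  refine ⟨staircaseSegments_subset_rcHull.trans hrc, triangle_subset_pcppHull,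
    rcHull_subset_staircaseSegments.antisymm staircaseSegments_subset_rcHull, hrc, fun h => ?_⟩
  have hmem : ((1 / 2 : ℝ), (1 / 2 : ℝ), (1 : ℝ)) ∈ rcHull spiralStaircase :=
    h (triangle_subset_pcppHull (subset_convexHull ℝ _ (by simp)))
  linarith [fst_le_zero_of_mem_rcHull_spiralStaircase hmem]
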